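/- Let $m\ge 3$ be an odd integer and let $D\subset\{0,1,\dots,m-1\}$ satisfy $1<\#D<m$. Let $$K_{m,D}=\Big\{\sum_{j=1}^{\infty}\frac{a_j}{m^j} : a_j\in D\text{ for all }j\ge 1\Big\}\subset[0,1]$$ be the associated missing-digit set. Let $(F_k)_{k\ge1}$ be the Fibonacci sequence, $F_1=F_2=1$ and $F_{k+2}=F_{k+1}+F_k$. Then the set $$\Big\{\frac{1}{\prod_{k=1}^{n}F_k} : n\ge 1\Big\}\cap K_{m,D}$$ is finite. -/

import Mathlib

/-- The missing-digit set `K_{m,D}`: all real numbers `∑_{j ≥ 1} a_j / m ^ j` with every digit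
`a_j ∈ D`. The digit `a_{j+1}` is `a j`. -/
def missingDigitSet (m : ℕ) (D : Finset ℕ) : Set ℝ :=
  {x | ∃ a : ℕ → ℕ, (∀ j, a j ∈ D) ∧ HasSum (fun j : ℕ => (a j : ℝ) / (m : ℝ) ^ (j + 1)) x}

/-- `a_n = F_1 F_2 ⋯ F_n`, with `F_1 = F_2 = 1`. -/
def fibProd (n : ℕ) : ℕ := ∏ k ∈ Finset.Icc 1 n, Nat.fib k

/-! ### Missing-digit sets -/

/-! Write `F_1 ⋯ F_n = 2 ^ e * M` with `M` odd. The set is invariant under multiplication by `m`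
modulo 1, so it is enough that some `m ^ j / (2 ^ e * M)` falls in the open gap of a missing digit.
If the primes of `M` are at most `2 ^ c`, some `m ^ (2 ^ c * W)`, `W` odd, is 1 modulo the part of
`M` coprime to `m`. Powers of its square still cover a full class `1 + 2 ^ (s + c) * w` modulo `2 ^
e`. By CRT the orbit meets a translate of the grid of mesh `2 ^ (s + c - e)`, finer than `1 / m`, at
every point. For Fibonacci products `e` grows like `3n/4`, while `c` grows like `7n/10`. -/

lemma mem_Icc_of_mem_missingDigitSet {m : ℕ} (hm : 2 ≤ m) {D : Finset ℕ}
    (hD : D ⊆ Finset.range m) {x : ℝ} (hx : x ∈ missingDigitSet m D) : 0 ≤ x ∧ x ≤ 1 := by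
  obtain ⟨a, ha, hs⟩ := hx
  have hm' : (2 : ℝ) ≤ m := by exact_mod_cast hm
  refine ⟨hs.nonneg fun j => by positivity, ?_⟩
  have hr : HasSum (fun j : ℕ => ((m : ℝ) - 1) / m * (1 / (m : ℝ)) ^ j) 1 := by
    have h := (hasSum_geometric_of_lt_one (r := 1 / (m : ℝ)) (by positivity)
      (by rw [div_lt_one (by linarith)]; linarith)).mul_left (((m : ℝ) - 1) / m)
    have h1 : (m : ℝ) - 1 ≠ 0 := by linarith
    have h0 : (m : ℝ) ≠ 0 := by linarith
    rwa [one_sub_div h0, inv_div, div_mul_div_cancel₀ h0, div_self h1] at h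
  refine hasSum_le (fun j => ?_) hs hr
  have h1 : (a j : ℝ) ≤ m - 1 := by
    have := Finset.mem_range.1 (hD (ha j))
    have : ((a j + 1 : ℕ) : ℝ) ≤ m := by exact_mod_cast this
    push_cast at this
    linarith
  calc (a j : ℝ) / (m : ℝ) ^ (j + 1) ≤ (m - 1) / (m : ℝ) ^ (j + 1) := by gcongr
    _ = _ := by rw [pow_succ, one_div, inv_pow]; field_simp

lemma exists_digit_of_mem_missingDigitSet {m : ℕ} (hm : 2 ≤ m) {D : Finset ℕ}
    {x : ℝ} (hx : x ∈ missingDigitSet m D) : ∃ d ∈ D, (m : ℝ) * x - d ∈ missingDigitSet m D := by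
  obtain ⟨a, ha, hs⟩ := hx
  have hm' : (m : ℝ) ≠ 0 := by positivity
  refine ⟨a 0, ha 0, fun j => a (j + 1), fun j => ha _, ?_⟩
  have h := (hasSum_nat_add_iff' 1).2 (hs.mul_left (m : ℝ))
  have h0 : (m : ℝ) * (a 0 / m ^ (0 + 1)) = a 0 := by
    rw [zero_add, pow_one, mul_div_cancel₀ _ hm']
  rw [Finset.sum_range_one, h0] at h
  have h1 : (fun j : ℕ => (a (j + 1) : ℝ) / (m : ℝ) ^ (j + 1))
      = fun j : ℕ => (m : ℝ) * (a (j + 1) / m ^ (j + 1 + 1)) := by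
    funext j
    rw [pow_succ (m : ℝ) (j + 1)]
    field_simp
  rw [h1]
  exact h

lemma exists_int_pow_mul_sub_mem_missingDigitSet {m : ℕ} (hm : 2 ≤ m) {D : Finset ℕ}
    {x : ℝ} (hx : x ∈ missingDigitSet m D) (j : ℕ) :
    ∃ z : ℤ, (m : ℝ) ^ j * x - z ∈ missingDigitSet m D := by
  induction j with
  | zero => exact ⟨0, by simpa using hx⟩
  | succ j ih =>
    obtain ⟨z, hz⟩ := ih
    obtain ⟨d, -, hd⟩ := exists_digit_of_mem_missingDigitSet hm hz
    refine ⟨m * z + d, ?_⟩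
    convert hd using 1
    push_cast
    ring

/-- No translate by an integer of the open `m`-adic interval of a missing digit meets
`missingDigitSet m D`. -/
lemma sub_int_notMem_missingDigitSet {m : ℕ} (hm : 2 ≤ m) {D : Finset ℕ}
    (hD : D ⊆ Finset.range m) {d : ℕ} (hdm : d < m) (hd : d ∉ D) {v : ℝ}
    (h1 : (d : ℝ) < m * v) (h2 : m * v < d + 1) (z : ℤ) : v - z ∉ missingDigitSet m D := by
  intro hv
  have hm' : (0 : ℝ) < m := by positivity
  have hdm' : (d : ℝ) + 1 ≤ m := by exact_mod_cast hdm
  obtain ⟨h3, h4⟩ := mem_Icc_of_mem_missingDigitSet hm hD hv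
  have hv0 : 0 < v := pos_of_mul_pos_right (lt_of_le_of_lt (Nat.cast_nonneg d) h1) hm'.le
  have hv1 : v < 1 := by
    by_contra h
    nlinarith [not_lt.1 h]
  have hz : z = 0 := by
    have ha : (z : ℝ) < 1 := by linarith
    have hb : (-1 : ℝ) < z := by linarith
    have ha' : z < 1 := by exact_mod_cast ha
    have hb' : -1 < z := by exact_mod_cast hb
    omega
  subst hz
  obtain ⟨d', hd', hv'⟩ := exists_digit_of_mem_missingDigitSet hm hv
  obtain ⟨h5, h6⟩ := mem_Icc_of_mem_missingDigitSet hm hD hv'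
  simp only [Int.cast_zero, sub_zero] at h5 h6
  have ha : (d' : ℝ) < d + 1 := by linarith
  have hb : (d : ℝ) < d' + 1 := by linarith
  have ha' : d' < d + 1 := by exact_mod_cast ha
  have hb' : d < d' + 1 := by exact_mod_cast hb
  obtain rfl : d = d' := by omega
  exact hd hd'

/-! ### Powers modulo powers of two -/

lemma one_add_two_pow_mul_odd_pow_odd {a u : ℤ} {s : ℕ} (hs : 1 ≤ s) (hu : Odd u)
    (ha : a = 1 + 2 ^ s * u) {W : ℕ} (hW : Odd W) : ∃ v, Odd v ∧ a ^ W = 1 + 2 ^ s * v := by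
  obtain ⟨k, rfl⟩ := hW
  obtain ⟨r, rfl⟩ := Nat.exists_eq_add_of_le' hs
  induction k with
  | zero => exact ⟨u, hu, by simpa using ha⟩
  | succ k ih =>
    obtain ⟨v, hv, h⟩ := ih
    obtain ⟨v, rfl⟩ := hv
    refine ⟨(2 * v + 1) + (1 + 2 ^ (r + 1) * (2 * v + 1)) * (2 * u + 2 ^ (r + 1) * u ^ 2),
      ?_, ?_⟩
    · exact ⟨v + (1 + 2 ^ (r + 1) * (2 * v + 1)) * (u + 2 ^ r * u ^ 2), by ring⟩
    · rw [show 2 * (k + 1) + 1 = (2 * k + 1) + 2 by ring, pow_add, h, ha]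
      ring

/-- Each squaring raises the 2-adic valuation of `a - 1` by exactly one; this fails for `s = 1`. -/
lemma one_add_two_pow_mul_odd_pow_two_pow {a u : ℤ} {s : ℕ} (hs : 2 ≤ s) (hu : Odd u)
    (ha : a = 1 + 2 ^ s * u) (i : ℕ) : ∃ v, Odd v ∧ a ^ 2 ^ i = 1 + 2 ^ (s + i) * v := by
  obtain ⟨r, rfl⟩ := Nat.exists_eq_add_of_le' hs
  induction i with
  | zero => exact ⟨u, hu, by simpa using ha⟩
  | succ i ih =>
    obtain ⟨v, hv, h⟩ := ih
    obtain ⟨v, rfl⟩ := hv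
    refine ⟨2 * v + 1 + 2 ^ (r + i + 1) * (2 * v + 1) ^ 2, ?_, ?_⟩
    · exact ⟨v + 2 ^ (r + i) * (2 * v + 1) ^ 2, by ring⟩
    · rw [pow_succ, pow_mul, h]
      ring

/-- Powers of `1 + 2 ^ s * odd` cover all residues `1 + 2 ^ s * w` modulo any power of two. -/
lemma exists_pow_modEq_one_add_two_pow_mul {a u : ℤ} {s : ℕ} (hs : 2 ≤ s) (hu : Odd u)
    (ha : a = 1 + 2 ^ s * u) (w : ℤ) (i : ℕ) :
    ∃ k : ℕ, ∃ z : ℤ, a ^ k = 1 + 2 ^ s * w + 2 ^ (s + i) * z := by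
  induction i with
  | zero => exact ⟨0, -w, by ring⟩
  | succ i ih =>
    obtain ⟨k, z, h⟩ := ih
    rcases Int.even_or_odd' z with ⟨y, rfl | rfl⟩
    · exact ⟨k, y, by rw [h]; ring⟩
    -- An odd error is made even by one more factor `a ^ 2 ^ i`.
    · obtain ⟨v, ⟨v, rfl⟩, hv⟩ := one_add_two_pow_mul_odd_pow_two_pow hs hu ha i
      obtain ⟨r, rfl⟩ := Nat.exists_eq_add_of_le' hs
      refine ⟨k + 2 ^ i, y + v + 1 +
        (2 ^ (r + 1) * w + 2 ^ (r + 1 + i) * (2 * y + 1)) * (2 * v + 1), ?_⟩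
      rw [pow_add, h, hv]
      ring

/-- Squaring `m` covers the case `m ≡ 3` mod 4. -/
lemma exists_sq_eq_one_add_two_pow_mul_odd {m : ℕ} (hm : 3 ≤ m) (hodd : Odd m) :
    ∃ s, 2 ≤ s ∧ ∃ u : ℤ, Odd u ∧ (m : ℤ) ^ 2 = 1 + 2 ^ s * u := by
  obtain ⟨k, rfl⟩ := hodd
  obtain ⟨r, v, hv, h⟩ := Nat.exists_eq_two_pow_mul_odd (n := k * (k + 1))
    (Nat.mul_ne_zero (by omega) (by omega))
  refine ⟨r + 2, by omega, v, by exact_mod_cast hv, ?_⟩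
  have h' : (k : ℤ) * (k + 1) = 2 ^ r * v := by exact_mod_cast h
  push_cast
  linear_combination 4 * h'

/-! ### Two-part of the multiplicative order -/

/-- The order of `m` modulo (the part coprime to `m` of) an odd number all of whose prime factors
are at most `2 ^ c` is not divisible by `2 ^ (c + 1)`. -/
lemma exists_dvd_pow_mul_pow_sub_one (m c : ℕ) (M : ℕ) (hodd : Odd M)
    (hp : ∀ q, q.Prime → q ∣ M → q ≤ 2 ^ c) :
    ∃ t W : ℕ, Odd W ∧ (M : ℤ) ∣ (m : ℤ) ^ t * ((m : ℤ) ^ (2 ^ c * W) - 1) := by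
  induction M using Nat.recOnPosPrimePosCoprime with
  | zero => simp at hodd
  | one => exact ⟨0, 1, odd_one, by simp⟩
  | prime_pow q a hq ha =>
    have hqodd : Odd q := (Nat.odd_pow_iff ha.ne').1 hodd
    by_cases hqm : q ∣ m
    · refine ⟨a, 1, odd_one, Dvd.dvd.mul_right ?_ _⟩
      exact_mod_cast pow_dvd_pow_of_dvd hqm a
    · obtain ⟨v, w, hw, h⟩ := Nat.exists_eq_two_pow_mul_odd (n := q - 1)
        (by have := hq.two_le; omega)
      have hvc : v ≤ c := by
        have h1 := hp q hq (dvd_pow_self q ha.ne')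
        have h2 : 2 ^ v ≤ q - 1 := Nat.le_of_dvd (by have := hq.two_le; omega) ⟨w, h⟩
        exact (Nat.pow_le_pow_iff_right (by norm_num)).1 (h2.trans ((Nat.sub_le _ _).trans h1))
      refine ⟨0, q ^ (a - 1) * w, hqodd.pow.mul hw, ?_⟩
      rw [pow_zero, one_mul]
      have hcop : m.Coprime (q ^ a) :=
        Nat.Coprime.pow_right _ ((Nat.Prime.coprime_iff_not_dvd hq).2 hqm).symm
      have h1 := (Nat.ModEq.pow_totient hcop).pow (2 ^ (c - v))
      rw [one_pow, ← pow_mul, Nat.totient_prime_pow hq ha, h,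
        show q ^ (a - 1) * (2 ^ v * w) * 2 ^ (c - v) = 2 ^ c * (q ^ (a - 1) * w) by
          rw [← Nat.add_sub_of_le hvc, Nat.add_sub_cancel_left, pow_add]; ring] at h1
      have h2 := (Nat.modEq_iff_dvd.1 h1.symm)
      exact_mod_cast h2
  | coprime a b ha hb hab iha ihb =>
    obtain ⟨hoa, hob⟩ := Nat.odd_mul.1 hodd
    obtain ⟨t, W, hW, h⟩ := iha hoa fun q hq hd => hp q hq (hd.mul_right _)
    obtain ⟨t', W', hW', h'⟩ := ihb hob fun q hq hd => hp q hq (hd.mul_left _)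
    refine ⟨t + t', W * W', hW.mul hW', ?_⟩
    push_cast
    refine IsCoprime.mul_dvd (Nat.isCoprime_iff_coprime.2 hab) ?_ ?_
    · refine h.trans (mul_dvd_mul (pow_dvd_pow _ (by omega)) ?_)
      rw [← mul_assoc, pow_mul (m : ℤ) (2 ^ c * W)]
      exact sub_one_dvd_pow_sub_one _ _
    · refine h'.trans (mul_dvd_mul (pow_dvd_pow _ (by omega)) ?_)
      rw [mul_comm W, ← mul_assoc, pow_mul (m : ℤ) (2 ^ c * W')]
      exact sub_one_dvd_pow_sub_one _ _

/-! ### Reciprocals with a large two-part -/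

/-- If the power of two in `N` is large compared with its prime factors, then `1 / N` is not in
the missing-digit set. -/
lemma one_div_notMem_missingDigitSet {m : ℕ} (hm : 3 ≤ m) (hodd : Odd m) {D : Finset ℕ}
    (hD : D ⊆ Finset.range m) (hDm : D.card < m) {s : ℕ} (hs : 2 ≤ s) {u : ℤ} (hu : Odd u)
    (hsu : (m : ℤ) ^ 2 = 1 + 2 ^ s * u) {c e M : ℕ} (hM : Odd M)
    (hp : ∀ q, q.Prime → q ∣ M → q ≤ 2 ^ c) (he : s + c + m ≤ e) :
    (1 / ((2 ^ e * M : ℕ) : ℝ)) ∉ missingDigitSet m D := by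
  intro hx
  obtain ⟨d, hdm, hd⟩ : ∃ d < m, d ∉ D := by
    by_contra! h
    have : Finset.range m ⊆ D := fun d hd => h d (Finset.mem_range.1 hd)
    have := Finset.card_le_card this
    simp at this
    omega
  obtain ⟨t, W, hW, hdvd⟩ := exists_dvd_pow_mul_pow_sub_one m c M hM hp
  obtain ⟨v, hv, hgv⟩ := one_add_two_pow_mul_odd_pow_two_pow hs hu hsu c
  obtain ⟨v', hv', hg⟩ := one_add_two_pow_mul_odd_pow_odd (by omega) hv hgv hW
  have hm0 : (0 : ℝ) < m := by positivity
  have hM0 : (0 : ℝ) < M := by exact_mod_cast hM.pos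
  set r := e - (s + c) with hr
  have hmr : (m : ℝ) < 2 ^ r := by
    have : m < 2 ^ r := Nat.lt_two_pow_self.trans_le (Nat.pow_le_pow_right (by norm_num) (by omega))
    exact_mod_cast this
  have her : e = s + c + r := by omega
  set y : ℝ := (m : ℝ) ^ t / (2 ^ e * M) with hy
  -- The first grid point `y + h / 2 ^ r` beyond `d / m`.
  set h : ℤ := ⌊((d : ℝ) / m - y) * 2 ^ r⌋ + 1 with hh
  -- This `w` makes `m ^ t * g ^ k ≡ m ^ t + h * 2 ^ (s + c) * M` modulo `2 ^ e`.
  obtain ⟨w, b, hw⟩ : ∃ w b : ℤ, (m : ℤ) ^ t * w = h * M + 2 ^ r * b := by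
    have hc : IsCoprime ((m : ℤ) ^ t) ((2 : ℤ) ^ r) := by
      refine IsCoprime.pow ?_
      exact_mod_cast Nat.isCoprime_iff_coprime.2 hodd.coprime_two_right
    obtain ⟨p, q, hpq⟩ := hc
    exact ⟨p * (h * M), -(q * (h * M)), by linear_combination (h * M : ℤ) * hpq⟩
  obtain ⟨k, z, hk⟩ := exists_pow_modEq_one_add_two_pow_mul (by omega : 2 ≤ s + c) hv' hg w r
  set g : ℤ := (((m : ℤ) ^ 2) ^ 2 ^ c) ^ W with hgdef
  have hgm : g = ((m : ℤ) ^ (2 ^ c * W)) ^ 2 := by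
    rw [hgdef]; ring
  have hMd : (M : ℤ) ∣ (m : ℤ) ^ t * (g ^ k - 1) := by
    refine hdvd.trans (mul_dvd_mul_left _ ?_)
    rw [hgm, ← pow_mul]
    exact sub_one_dvd_pow_sub_one _ _
  have h2 : (2 : ℤ) ^ e ∣ (m : ℤ) ^ t * (g ^ k - 1) - h * 2 ^ (s + c) * M := by
    refine ⟨b + (m : ℤ) ^ t * z, ?_⟩
    rw [hk, her]
    linear_combination (2 : ℤ) ^ (s + c) * hw
  have hcop : IsCoprime ((2 : ℤ) ^ e) (M : ℤ) := by
    refine IsCoprime.pow_left ?_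
    exact_mod_cast Nat.isCoprime_iff_coprime.2 hM.coprime_two_left
  obtain ⟨n, hn⟩ := hcop.mul_dvd h2 (dvd_sub hMd (dvd_mul_left _ _))
  obtain ⟨z', hz'⟩ := exists_int_pow_mul_sub_mem_missingDigitSet (by omega) hx
    (t + 2 * (2 ^ c * W) * k)
  have hpow : (m : ℝ) ^ (t + 2 * (2 ^ c * W) * k)
      = m ^ t + h * 2 ^ (s + c) * M + 2 ^ e * M * n := by
    have : (m : ℤ) ^ (t + 2 * (2 ^ c * W) * k)
      = m ^ t + h * 2 ^ (s + c) * M + 2 ^ e * M * n := by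
      have h3 : (m : ℤ) ^ (t + 2 * (2 ^ c * W) * k) = (m : ℤ) ^ t * g ^ k := by
        rw [hgm, pow_add, ← pow_mul, ← pow_mul]
        ring
      rw [h3]
      linear_combination hn
    exact_mod_cast this
  have hval : (m : ℝ) ^ (t + 2 * (2 ^ c * W) * k) * (1 / ((2 ^ e * M : ℕ) : ℝ)) - z'
      = (y + h / 2 ^ r) - ((z' - n : ℤ) : ℝ) := by
    rw [hpow, hy, her]
    push_cast
    field_simp
    ring
  rw [hval] at hz'
  have hfl := Int.floor_le (((d : ℝ) / m - y) * 2 ^ r)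
  have hfl' := Int.lt_floor_add_one (((d : ℝ) / m - y) * 2 ^ r)
  have hhr : (h : ℝ) = ⌊((d : ℝ) / m - y) * 2 ^ r⌋ + 1 := by rw [hh]; push_cast; ring
  have hr0 : (0 : ℝ) < 2 ^ r := by positivity
  refine sub_int_notMem_missingDigitSet (by omega) hD hdm hd ?_ ?_ _ hz'
  · have h4 : (d : ℝ) / m - y < h / 2 ^ r := by rw [lt_div_iff₀ hr0]; linarith
    rw [mul_comm, ← div_lt_iff₀ hm0]
    linarith
  · have h4 : (h : ℝ) / 2 ^ r ≤ (d : ℝ) / m - y + 1 / 2 ^ r := by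
      rw [div_le_iff₀ hr0, add_mul, one_div_mul_cancel hr0.ne']
      linarith
    have h5 : (1 : ℝ) / 2 ^ r < 1 / m := one_div_lt_one_div_of_lt hm0 hmr
    rw [mul_comm, ← lt_div_iff₀ hm0, add_div]
    linarith

/-! ### Products of Fibonacci numbers -/

/-- `φ ^ 10 < 123 < 128 = 2 ^ 7`. -/
lemma fib_ten_mul_le (j : ℕ) :
    Nat.fib (10 * j) ≤ 2 * 128 ^ j ∧ Nat.fib (10 * j + 1) ≤ 3 * 128 ^ j := by
  induction j with
  | zero => simp
  | succ j ih =>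
    have h1 := Nat.fib_add (10 * j) 9
    have h2 := Nat.fib_add (10 * j) 10
    norm_num [Nat.fib_add_two] at h1 h2
    rw [pow_succ, show 10 * (j + 1) = 10 * j + 10 by ring]
    norm_num [Nat.fib_add_two] at *
    omega

lemma fib_le_two_pow (n : ℕ) : Nat.fib n ≤ 2 ^ (7 * (n / 10 + 1) + 1) := by
  calc Nat.fib n ≤ Nat.fib (10 * (n / 10 + 1)) := Nat.fib_mono (by omega)
    _ ≤ 2 * 128 ^ (n / 10 + 1) := (fib_ten_mul_le _).1
    _ = _ := by rw [pow_succ 2, pow_mul]; norm_num; ring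

lemma fibProd_dvd_fibProd {a b : ℕ} (h : a ≤ b) : fibProd a ∣ fibProd b :=
  Finset.prod_dvd_prod_of_subset _ _ _ (Finset.Icc_subset_Icc_right h)

lemma fibProd_succ (n : ℕ) : fibProd (n + 1) = fibProd n * Nat.fib (n + 1) :=
  Finset.prod_Icc_succ_top (by omega) _

lemma fibProd_ne_zero (n : ℕ) : fibProd n ≠ 0 :=
  Finset.prod_ne_zero_iff.2 fun k hk =>
    (Nat.fib_pos.2 (by have := (Finset.mem_Icc.1 hk).1; omega)).ne'

/-- Each block of twelve indices contributes `1 + 3 + 1 + 4 = 9` factors of two. -/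
lemma two_pow_dvd_fibProd_twelve_mul (j : ℕ) : 2 ^ (9 * j) ∣ fibProd (12 * j) := by
  induction j with
  | zero => simp
  | succ j ih =>
    have h3 : 2 ∣ Nat.fib (12 * j + 3) := Nat.fib_dvd 3 _ (by omega)
    have h6 : 8 ∣ Nat.fib (12 * j + 6) := Nat.fib_dvd 6 _ (by omega)
    have h9 : 2 ∣ Nat.fib (12 * j + 9) := Nat.fib_dvd 3 _ (by omega)
    have h12 : 16 ∣ Nat.fib (12 * j + 12) :=
      (by decide : 16 ∣ 144).trans (Nat.fib_dvd 12 _ (by omega))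
    have a3 : 2 ^ (9 * j) * 2 ∣ fibProd (12 * j + 3) := by
      rw [fibProd_succ]
      exact mul_dvd_mul (ih.trans (fibProd_dvd_fibProd (by omega))) h3
    have a6 : 2 ^ (9 * j) * 2 * 8 ∣ fibProd (12 * j + 6) := by
      rw [fibProd_succ]
      exact mul_dvd_mul (a3.trans (fibProd_dvd_fibProd (by omega))) h6
    have a9 : 2 ^ (9 * j) * 2 * 8 * 2 ∣ fibProd (12 * j + 9) := by
      rw [fibProd_succ]
      exact mul_dvd_mul (a6.trans (fibProd_dvd_fibProd (by omega))) h9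
    have a12 : 2 ^ (9 * j) * 2 * 8 * 2 * 16 ∣ fibProd (12 * j + 12) := by
      rw [fibProd_succ]
      exact mul_dvd_mul (a9.trans (fibProd_dvd_fibProd (by omega))) h12
    rw [show 12 * (j + 1) = 12 * j + 12 by ring]
    convert a12 using 1
    ring

lemma prime_le_of_dvd_fibProd {n q : ℕ} (hq : q.Prime) (h : q ∣ fibProd n) : q ≤ Nat.fib n := by
  obtain ⟨k, hk, hd⟩ := (hq.prime.dvd_finsetProd_iff _).1 h
  obtain ⟨h1, h2⟩ := Finset.mem_Icc.1 hk
  exact (Nat.le_of_dvd (Nat.fib_pos.2 (by omega)) hd).trans (Nat.fib_mono h2)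

theorem mainTheorem7 (m : ℕ) (hm : 3 ≤ m) (hodd : Odd m) (D : Finset ℕ)
    (hD : D ⊆ Finset.range m) (hD1 : 1 < D.card) (hDm : D.card < m) :
    ({x : ℝ | ∃ n : ℕ, 1 ≤ n ∧ x = 1 / (fibProd n : ℝ)} ∩ missingDigitSet m D).Finite := by
  obtain ⟨s, hs, u, hu, hsu⟩ := exists_sq_eq_one_add_two_pow_mul_odd hm hodd
  -- `9/12 - 7/10 = 1/20`; the 17 absorbs the floors and additive constants.
  refine ((Set.finite_lt_nat (20 * (s + m + 17))).image fun n => 1 / (fibProd n : ℝ)).subset ?_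
  rintro x ⟨⟨n, -, rfl⟩, hx⟩
  refine ⟨n, ?_, rfl⟩
  by_contra hn
  simp only [Set.mem_ofPred_eq, not_lt] at hn
  obtain ⟨e, M, hM, hN⟩ := Nat.exists_eq_two_pow_mul_odd (fibProd_ne_zero n)
  have he : 9 * (n / 12) ≤ e := by
    have h1 : 2 ^ (9 * (n / 12)) ∣ 2 ^ e * M := by
      rw [← hN]
      exact (two_pow_dvd_fibProd_twelve_mul _).trans (fibProd_dvd_fibProd (by omega))
    exact (Nat.pow_dvd_pow_iff_le_right (by norm_num)).1
      ((Nat.Coprime.pow_left _ hM.coprime_two_left).dvd_of_dvd_mul_right h1)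
  rw [hN] at hx
  refine one_div_notMem_missingDigitSet hm hodd hD hDm hs hu hsu
    (c := 7 * (n / 10 + 1) + 1) hM (fun q hq hd => ?_) (by omega) hx
  exact (prime_le_of_dvd_fibProd hq (hN ▸ hd.mul_left _)).trans (fib_le_two_pow n)
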